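/- Let $G=(V,E)$ be a finite triangulated Laman graph, i.e. a graph that has a Henneberg construction of the following kind: start with two vertices joined by an edge and repeatedly add a new vertex joined by two new edges to the two end points of an existing edge. For a configuration $p=(\vec x_i)_{i\in V}\in(\mathbb{R}^2)^V$ write $d_{ij}=\|\vec x_i-\vec x_j\|$, and let $P_G$ be the set of configurations with $\vec x_i\ne\vec x_j$ for all $(i,j)\in E$. Let $f_{ij}=f_{ji}\in\mathcal U$ for every $(i,j)\in E$, where $\mathcal U$ is the set of continuously differentiable $f:(0,\infty)\to\mathbb{R}$ such that $\frac{d}{dx}(xf(x))>0$ for all $x>0$, $f$ has a unique zero, and $\lim_{x\to0^+}\int_x^1 tf(t)\,dt=-\infty$. (In particular one may take $f_{ij}=u(\cdot,\bar d_{ij})$ for one control function $u$ and target distances $\bar d_{ij}>0$, provided these functions lie in $\mathcal U$.) Let $p\in P_G$ be an equilibrium of $$\dot{\vec x}_i=\sum_{j:(i,j)\in E}f_{ij}(d_{ij})\,(\vec x_j-\vec x_i),\qquad i\in V,$$ and let $H_p$ be the Hessian matrix at $p$ of the potential $\Phi=\sum_{(i,j)\in E}\int_1^{d_{ij}}tf_{ij}(t)\,dt$.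 The independent partition of $E$ associated with $(G,p)$ is built along a Henneberg construction of $G$ as above: it starts with the single class consisting of the first edge; when a new vertex $v$ is joined to the end points $j,k$ of an existing edge, then, if $\vec x_j,\vec x_k,\vec x_v$ are collinear, the edges $(j,v)$ and $(k,v)$ are added to the class that contains $(j,k)$; otherwise $\{(j,v)\}$ and $\{(k,v)\}$ are added as two new classes. Let $E_1,\dots,E_m$ be the classes of the independent partition built along any Henneberg construction of $G$ as above. For each $i$ let $V_i$ be the set of vertices incident to edges in $E_i$, let $p_i$ be the restriction of $p$ to $V_i$, let $\Phi_i=\sum_{(j,k)\in E_i}\int_1^{d_{jk}}tf_{jk}(t)\,dt$ be the potential on $(\mathbb{R}^2)^{V_i}$ of the subsystem induced by $G_i=(V_i,E_i)$, and let $H_{p_i}$ be the Hessian matrix of $\Phi_i$ at $p_i$. Let $n_-$ and $n_+$ denote the numbers of negative and of positive eigenvalues of a real symmetric matrix, counted with multiplicity. Then $$n_-(H_p)=\sum_{i=1}^m n_-(H_{p_i}),\qquad n_+(H_p)=\sum_{i=1}^m n_+(H_{p_i}).$$ -/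

import Mathlib

namespace Formation

/-- The plane `ℝ²` with its Euclidean norm. -/
abbrev Plane : Type := EuclideanSpace ℝ (Fin 2)

/-! ### Interaction laws, configurations, the formation control system -/

/-- The class `𝒰` of interaction laws: `C¹` functions `f` on the positive reals such that
`d/dx (x f(x)) > 0` for all `x > 0`, `f` has exactly one zero in `(0, ∞)`, and
`∫ₓ¹ t f(t) dt → -∞` as `x → 0⁺`. Values of `f` outside `(0, ∞)` play no role. -/
def interactionLaws : Set (ℝ → ℝ) :=
  {f | ContDiffOn ℝ 1 f (Set.Ioi 0) ∧
    (∀ x : ℝ, 0 < x → 0 < deriv (fun y : ℝ => y * f y) x) ∧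
    (∃! x : ℝ, 0 < x ∧ f x = 0) ∧
    Filter.Tendsto (fun x : ℝ => ∫ t in x..1, t * f t) (nhdsWithin 0 (Set.Ioi 0)) Filter.atBot}

/-- The configuration space `P_G`: adjacent vertices have distinct positions. -/
def configurationSpace {V : Type*} (G : SimpleGraph V) : Set (V → Plane) :=
  {x | ∀ i j : V, G.Adj i j → x i ≠ x j}

/-- The distance between the two end points of a pair of vertices in the configuration `x`. -/
noncomputable def edgeLength {V : Type*} (x : V → Plane) (e : Sym2 V) : ℝ :=
  Sym2.lift ⟨fun i j => dist (x i) (x j), fun i j => dist_comm (x i) (x j)⟩ e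

open Classical in
/-- `p` is an equilibrium of `ẋᵢ = ∑_{j ~ i} f_{ij}(d_{ij}) (xⱼ - xᵢ)`, `i ∈ V`. -/
def IsEquilibrium {V : Type*} [Fintype V] (G : SimpleGraph V) (f : Sym2 V → ℝ → ℝ)
    (p : V → Plane) : Prop :=
  p ∈ configurationSpace G ∧
    ∀ i : V, ∑ j ∈ G.neighborFinset i, f s(i, j) (dist (p i) (p j)) • (p j - p i) = 0

open Classical in
/-- The potential `Φ(x) = ∑_{(i,j) ∈ E} ∫₁^{d_{ij}} t f_{ij}(t) dt`. -/
noncomputable def potential {V : Type*} [Fintype V] (G : SimpleGraph V) (f : Sym2 V → ℝ → ℝ)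
    (x : V → Plane) : ℝ :=
  ∑ e ∈ G.edgeFinset, ∫ t in (1 : ℝ)..(edgeLength x e), t * f e t

/-! ### Hessian matrices and their signature -/

open Classical in
/-- The standard basis vector of `(ℝ²)^V` for coordinate `a.2` of agent `a.1`. -/
noncomputable def coordVec {V : Type*} (a : V × Fin 2) : V → Plane :=
  Pi.single a.1 (EuclideanSpace.single a.2 (1 : ℝ))

/-- The Hessian matrix of `F` at `p`: its entries are the second partial derivatives. -/
noncomputable def hessian {V : Type*} [Fintype V] (F : (V → Plane) → ℝ) (p : V → Plane) :
    Matrix (V × Fin 2) (V × Fin 2) ℝ :=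
  Matrix.of fun a b =>
    fderiv ℝ (fun q : V → Plane => fderiv ℝ F q (coordVec b)) p (coordVec a)

open Classical in
/-- Number of negative eigenvalues of a real matrix, counted with multiplicity. -/
noncomputable def numNeg {n : Type*} [Fintype n] (A : Matrix n n ℝ) : ℕ :=
  (A.charpoly.roots.filter (fun r : ℝ => r < 0)).card

open Classical in
/-- Number of positive eigenvalues of a real matrix, counted with multiplicity. -/
noncomputable def numPos {n : Type*} [Fintype n] (A : Matrix n n ℝ) : ℕ :=
  (A.charpoly.roots.filter (fun r : ℝ => 0 < r)).card

/-! ### Triangulated Laman graphs and independent partitions -/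

/-- `HennebergSeq S E` is the type of Henneberg sequences with triangulated vertex-add steps that
end in the graph with vertex set `S` and edge set `E`: start with two vertices joined by an edge,
and repeatedly add a new vertex `v` joined to the two end points `j`, `k` of an existing edge. -/
inductive HennebergSeq {V : Type*} : Set V → Set (Sym2 V) → Type _
  | base (a b : V) (hab : a ≠ b) : HennebergSeq {a, b} {s(a, b)}
  | step {S : Set V} {E : Set (Sym2 V)} (h : HennebergSeq S E) (v j k : V)
      (hv : v ∉ S) (hjk : s(j, k) ∈ E) :
      HennebergSeq (insert v S) (E ∪ {s(j, v), s(k, v)})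

/-- A Henneberg construction of the graph `G` (on all of its vertices). -/
abbrev HennebergConstruction {V : Type*} (G : SimpleGraph V) : Type _ :=
  HennebergSeq (Set.univ : Set V) G.edgeSet

/-- A triangulated Laman graph: a graph that admits a Henneberg construction as above. -/
def IsTriangulatedLaman {V : Type*} (G : SimpleGraph V) : Prop :=
  Nonempty (HennebergConstruction G)

open Classical in
/-- The independent partition of the edge set, built along a Henneberg sequence. When `v` is
attached to the edge `(j,k)`: if `xⱼ, x_k, x_v` are aligned, both new edges join the class that
contains `(j,k)`; otherwise each of the two new edges forms a class of its own. -/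
noncomputable def HennebergSeq.independentPartition {V : Type*} (x : V → Plane) :
    {S : Set V} → {E : Set (Sym2 V)} → HennebergSeq S E → Finset (Set (Sym2 V))
  | _, _, .base a b _ => {{s(a, b)}}
  | _, _, .step h v j k _ _ =>
      if Collinear ℝ {x j, x k, x v} then
        (h.independentPartition x).image
          (fun C => if s(j, k) ∈ C then C ∪ {s(j, v), s(k, v)} else C)
      else
        h.independentPartition x ∪ {{s(j, v)}, {s(k, v)}}

/-! ### The subsystem carried by a set of edges -/

/-- The set of vertices incident to the edges in `C`. -/
def partVerts {V : Type*} (C : Set (Sym2 V)) : Set V := {v | ∃ e ∈ C, v ∈ e}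

noncomputable instance partVerts.instFintype {V : Type*} [Fintype V] (C : Set (Sym2 V)) :
    Fintype (partVerts C) := Fintype.ofFinite _

/-- The graph whose vertices are those incident to `C` and whose edges are those in `C`. -/
def partGraph {V : Type*} (C : Set (Sym2 V)) : SimpleGraph (partVerts C) :=
  (SimpleGraph.fromEdgeSet C).induce (partVerts C)

/-- The interaction laws of the subsystem. -/
def partLaws {V : Type*} (f : Sym2 V → ℝ → ℝ) (C : Set (Sym2 V)) :
    Sym2 (partVerts C) → ℝ → ℝ :=
  fun e => f (e.map Subtype.val)

/-- The configuration of the subsystem. -/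
def partConfig {V : Type*} (p : V → Plane) (C : Set (Sym2 V)) : partVerts C → Plane :=
  fun v => p v.1

/-- The potential of the subsystem. -/
noncomputable def partPotential {V : Type*} [Fintype V] (f : Sym2 V → ℝ → ℝ)
    (C : Set (Sym2 V)) : (partVerts C → Plane) → ℝ :=
  potential (partGraph C) (partLaws f C)

end Formation

/-! The second derivative of the potential is a sum over edges, so its quadratic form `Q` on
displacements is the sum over classes `C` of forms `Q_C` evaluated on the restricted displacement.
Two facts about the independent partition make the signature additive. Mechanics: at an equilibrium
every class is in equilibrium by itself (`isStress_of_mem_independentPartition`), hence `Q_C` is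
unchanged by infinitesimal rigid motions of `C` (`potentialForm_add_rigidMotion`). Kinematics:
displacements prescribed independently on the classes are restrictions of one global displacement,
up to a rigid motion of each class (`exists_displacement`). Thus `Q` is the pullback of an
orthogonal sum of forms on the quotients by rigid motions along a surjective linear map, and the
indices add (`HasNegIndex.card_eq_sum`). Positive indices are negative indices of `-Q`. -/

namespace Formation

/-! ### Negative index of a form, and its additivity. -/

/-- `Q` is negative on the nonzero vectors of an injectively embedded `ℝ^κ` and nonnegative on the
kernel of a linear map to `ℝ^κ`; for a quadratic form this says that its negative index is the
cardinality of `κ`. -/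
def HasNegIndex {X : Type*} [AddCommGroup X] [Module ℝ X] (Q : X → ℝ) (κ : Type*) : Prop :=
  (∃ w : (κ → ℝ) →ₗ[ℝ] X, ∀ c, c ≠ 0 → Q (w c) < 0) ∧
    ∃ q : X →ₗ[ℝ] (κ → ℝ), ∀ x, q x = 0 → 0 ≤ Q x

lemma HasNegIndex.comp_equiv {X Y κ : Type*} [AddCommGroup X] [Module ℝ X] [AddCommGroup Y]
    [Module ℝ Y] {Q : X → ℝ} (h : HasNegIndex Q κ) (e : Y ≃ₗ[ℝ] X) :
    HasNegIndex (fun y => Q (e y)) κ := by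
  obtain ⟨⟨w, hw⟩, q, hq⟩ := h
  exact ⟨⟨e.symm.toLinearMap ∘ₗ w, fun c hc => by simpa using hw c hc⟩,
    q ∘ₗ e.toLinearMap, fun y hy => hq _ hy⟩

lemma HasNegIndex.reindex {X κ μ : Type*} [AddCommGroup X] [Module ℝ X] {Q : X → ℝ}
    (h : HasNegIndex Q κ) (e : κ ≃ μ) : HasNegIndex Q μ := by
  obtain ⟨⟨w, hw⟩, q, hq⟩ := h
  refine ⟨⟨w ∘ₗ (LinearEquiv.funCongrLeft ℝ ℝ e).toLinearMap, fun c hc => hw _ ?_⟩,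
    (LinearEquiv.funCongrLeft ℝ ℝ e.symm).toLinearMap ∘ₗ q, fun x hx => hq _ ?_⟩
  · exact (LinearEquiv.funCongrLeft ℝ ℝ e).map_ne_zero_iff.mpr hc
  · exact (LinearEquiv.funCongrLeft ℝ ℝ e.symm).map_eq_zero_iff.mp hx

/-- A nonzero `c` killed by `q ∘ w` would make `Q (w c)` both negative and nonnegative, so `q ∘ w`
is injective. This is the only dimension count: it makes the index unique and yields both
inequalities of additivity. -/
lemma card_le_of_neg_of_nonneg {X κ μ : Type*} [AddCommGroup X] [Module ℝ X] [Fintype κ]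
    [Fintype μ] {Q : X → ℝ} (w : (κ → ℝ) →ₗ[ℝ] X) (hw : ∀ c, c ≠ 0 → Q (w c) < 0)
    (q : X →ₗ[ℝ] (μ → ℝ)) (hq : ∀ x, q x = 0 → 0 ≤ Q x) : Fintype.card κ ≤ Fintype.card μ := by
  have hinj : Function.Injective (q ∘ₗ w) := by
    rw [← LinearMap.ker_eq_bot, LinearMap.ker_eq_bot']
    intro c hc
    by_contra h
    exact absurd (hw c h) (not_lt.mpr (hq _ hc))
  simpa using LinearMap.finrank_le_finrank_of_injective hinj

/-- Additivity of the negative index for a form assembled from forms on quotients of the restricted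
spaces, when the restriction map onto the product of the quotients is surjective. -/
theorem HasNegIndex.card_eq_sum {ι : Type*} [Fintype ι] {X : Type*} [AddCommGroup X] [Module ℝ X]
    {Y : ι → Type*} [∀ i, AddCommGroup (Y i)] [∀ i, Module ℝ (Y i)]
    {Q : X → ℝ} {Qᵢ : ∀ i, Y i → ℝ} (R : ∀ i, X →ₗ[ℝ] Y i) (N : ∀ i, Submodule ℝ (Y i))
    (hQ : ∀ x, Q x = ∑ i, Qᵢ i (R i x))
    (h0 : ∀ i, Qᵢ i 0 = 0)
    (hN : ∀ i y, ∀ n ∈ N i, Qᵢ i (y + n) = Qᵢ i y)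
    (hR : ∀ r : ∀ i, Y i, ∃ x, ∀ i, R i x - r i ∈ N i)
    {κ : Type*} [Fintype κ] {κᵢ : ι → Type*} [∀ i, Fintype (κᵢ i)]
    (h : HasNegIndex Q κ) (hᵢ : ∀ i, HasNegIndex (Qᵢ i) (κᵢ i)) :
    Fintype.card κ = ∑ i, Fintype.card (κᵢ i) := by
  classical
  obtain ⟨⟨w, hw⟩, q, hq⟩ := h
  choose hᵢ₁ hᵢ₂ using hᵢ
  choose wᵢ hwᵢ using hᵢ₁
  choose qᵢ hqᵢ using hᵢ₂
  rw [← Fintype.card_sigma]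
  apply le_antisymm
  -- On the common kernel of all `qᵢ ∘ Rᵢ` every summand is nonnegative.
  · refine card_le_of_neg_of_nonneg w hw
      (LinearMap.pi fun a : (Σ i, κᵢ i) => LinearMap.proj a.2 ∘ₗ qᵢ a.1 ∘ₗ R a.1) fun x hx => ?_
    rw [hQ]
    refine Finset.sum_nonneg fun i _ => hqᵢ i _ ?_
    ext k
    exact congrFun hx ⟨i, k⟩
  · let P : X →ₗ[ℝ] (∀ i, Y i ⧸ N i) := LinearMap.pi fun i => (N i).mkQ ∘ₗ R i
    have hP : LinearMap.range P = ⊤ := by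
      rw [LinearMap.range_eq_top]
      intro z
      choose r hr using fun i => (N i).mkQ_surjective (z i)
      obtain ⟨x, hx⟩ := hR r
      refine ⟨x, ?_⟩
      ext i
      rw [← hr]
      exact (Submodule.Quotient.eq _).mpr (hx i)
    obtain ⟨σ, hσ⟩ := P.exists_rightInverse_of_surjective hP
    let W : ((Σ i, κᵢ i) → ℝ) →ₗ[ℝ] (∀ i, Y i) :=
      LinearMap.pi fun i => wᵢ i ∘ₗ LinearMap.funLeft ℝ ℝ (fun k => (⟨i, k⟩ : Σ i, κᵢ i))
    let T : (∀ i, Y i) →ₗ[ℝ] (∀ i, Y i ⧸ N i) :=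
      LinearMap.pi fun i => (N i).mkQ ∘ₗ LinearMap.proj i
    -- A family `W c` need not be the restriction of a single vector of `X`. Passing to the
    -- quotients and lifting by the section `σ` gives one whose restrictions differ from `W c` only
    -- by elements of `N i`, which `Qᵢ` does not see.
    refine card_le_of_neg_of_nonneg (σ ∘ₗ T ∘ₗ W) (fun c hc => ?_) q hq
    have key : ∀ i, Qᵢ i (R i (σ (T (W c)))) = Qᵢ i (W c i) := by
      intro i
      have h1 : P (σ (T (W c))) = T (W c) := LinearMap.congr_fun hσ _
      have h2 : R i (σ (T (W c))) - W c i ∈ N i :=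
        (Submodule.Quotient.eq _).mp (congrFun h1 i)
      simpa using hN i (W c i) _ h2
    have hle : ∀ i, Qᵢ i (W c i) ≤ 0 := by
      intro i
      by_cases hci : LinearMap.funLeft ℝ ℝ (fun k => (⟨i, k⟩ : Σ i, κᵢ i)) c = 0
      · have : W c i = 0 := by simp [W, hci]
        rw [this, h0]
      · exact (hwᵢ i _ hci).le
    change Q (σ (T (W c))) < 0
    rw [hQ, Finset.sum_congr rfl fun i _ => key i]
    obtain ⟨⟨i, k⟩, hik⟩ := Function.ne_iff.mp hc
    refine lt_of_lt_of_eq (Finset.sum_lt_sum (fun i _ => hle i) ⟨i, Finset.mem_univ i, ?_⟩)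
      Finset.sum_const_zero
    exact hwᵢ i _ fun h => hik (congrFun h k)

/-! ### Eigenvalue counts of symmetric matrices as indices. -/

section Matrix

variable {n : Type*} [Fintype n]

lemma dotProduct_mulVec_eq_sum_eigenvalues [DecidableEq n] {A : Matrix n n ℝ} (hA : A.IsHermitian)
    (x : n → ℝ) :
    x ⬝ᵥ A.mulVec x =
      ∑ i, hA.eigenvalues i * (hA.eigenvectorBasis.repr (WithLp.toLp 2 x) i) ^ 2 := by
  set b := hA.eigenvectorBasis
  have h1 : x = ∑ i, b.repr (WithLp.toLp 2 x) i • (b i : n → ℝ) := by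
    have := congrArg (WithLp.ofLp) (b.sum_repr (WithLp.toLp 2 x))
    simpa using this.symm
  have h2 : A.mulVec x = ∑ i, (hA.eigenvalues i * b.repr (WithLp.toLp 2 x) i) • (b i : n → ℝ) := by
    conv_lhs => rw [h1]
    rw [Matrix.mulVec_sum]
    refine Finset.sum_congr rfl fun i _ => ?_
    rw [Matrix.mulVec_smul, hA.mulVec_eigenvectorBasis, smul_smul, mul_comm]
  rw [h2, dotProduct_sum]
  refine Finset.sum_congr rfl fun i _ => ?_
  have h3 : b.repr (WithLp.toLp 2 x) i = x ⬝ᵥ (b i : n → ℝ) := by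
    rw [b.repr_apply_apply, EuclideanSpace.inner_eq_star_dotProduct]
    simp
  rw [dotProduct_smul, ← h3, smul_eq_mul]
  ring

/-- In diagonal form the two witnesses are extension by zero from the negative coordinates and
projection onto them. -/
lemma hasNegIndex_sum_mul_sq [DecidableEq n] {X : Type*} [AddCommGroup X] [Module ℝ X]
    (e : X ≃ₗ[ℝ] (n → ℝ)) (l : n → ℝ) :
    HasNegIndex (fun x => ∑ i, l i * (e x i) ^ 2) {i // l i < 0} := by
  refine ⟨⟨e.symm.toLinearMap ∘ₗ
    LinearMap.pi fun i => if h : l i < 0 then LinearMap.proj ⟨i, h⟩ else 0, fun c hc => ?_⟩,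
    LinearMap.pi fun i => LinearMap.proj i.1 ∘ₗ e.toLinearMap, fun x hx => ?_⟩
  · obtain ⟨⟨i, hi⟩, hci⟩ := Function.ne_iff.mp hc
    refine lt_of_lt_of_eq (Finset.sum_lt_sum (g := fun _ => (0 : ℝ)) (fun j _ => ?_)
      ⟨i, Finset.mem_univ i, ?_⟩) Finset.sum_const_zero
    · by_cases hj : l j < 0
      · exact mul_nonpos_of_nonpos_of_nonneg hj.le (sq_nonneg _)
      · simp [hj]
    · have : 0 < c ⟨i, hi⟩ ^ 2 := by
        have : c ⟨i, hi⟩ ≠ 0 := hci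
        positivity
      simpa [hi] using mul_neg_of_neg_of_pos hi this
  · refine Finset.sum_nonneg fun i _ => ?_
    by_cases hi : l i < 0
    · have : e x i = 0 := congrFun hx ⟨i, hi⟩
      simp [this]
    · exact mul_nonneg (not_lt.mp hi) (sq_nonneg _)

open Classical in
lemma card_filter_roots_charpoly {A : Matrix n n ℝ} (hA : A.IsHermitian) (P : ℝ → Prop) :
    (A.charpoly.roots.filter P).card = Fintype.card {i // P (hA.eigenvalues i)} := by
  rw [hA.roots_charpoly_eq_eigenvalues, Fintype.card_subtype, Multiset.filter_map,
    Multiset.card_map]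
  simp [Finset.card_def]

lemma hasNegIndex_numNeg {A : Matrix n n ℝ} (hA : A.IsHermitian) :
    HasNegIndex (fun x : n → ℝ => x ⬝ᵥ A.mulVec x) (Fin (numNeg A)) := by
  classical
  have h := hasNegIndex_sum_mul_sq ((WithLp.linearEquiv 2 ℝ (n → ℝ)).symm.trans
    (hA.eigenvectorBasis.repr.toLinearEquiv.trans (WithLp.linearEquiv 2 ℝ (n → ℝ)))) hA.eigenvalues
  have hc : numNeg A = Fintype.card {i // hA.eigenvalues i < 0} := by
    rw [← card_filter_roots_charpoly hA (fun r => r < 0)]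
    unfold numNeg
    congr!
  rw [hc]
  refine HasNegIndex.reindex ?_ (Fintype.equivFin _)
  convert h using 2 with x
  exact dotProduct_mulVec_eq_sum_eigenvalues hA x

lemma hasNegIndex_numPos {A : Matrix n n ℝ} (hA : A.IsHermitian) :
    HasNegIndex (fun x : n → ℝ => -(x ⬝ᵥ A.mulVec x)) (Fin (numPos A)) := by
  classical
  have h := hasNegIndex_sum_mul_sq ((WithLp.linearEquiv 2 ℝ (n → ℝ)).symm.trans
    (hA.eigenvectorBasis.repr.toLinearEquiv.trans (WithLp.linearEquiv 2 ℝ (n → ℝ))))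
    (fun i => -hA.eigenvalues i)
  have hc : numPos A = Fintype.card {i // -hA.eigenvalues i < 0} := by
    have := card_filter_roots_charpoly hA (fun r => 0 < r)
    simp only [neg_lt_zero]
    rw [← this]
    unfold numPos
    congr!
  rw [hc]
  refine HasNegIndex.reindex ?_ (Fintype.equivFin _)
  convert h using 2 with x
  rw [dotProduct_mulVec_eq_sum_eigenvalues hA x, ← Finset.sum_neg_distrib]
  exact Finset.sum_congr rfl fun i _ => (neg_mul _ _).symm

end Matrix

/-! ### Edge forms and the Hessian of the potential. -/

open scoped RealInnerProductSpace

variable {V : Type*}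

/-- The difference of the positions of `i` and `j`. -/
noncomputable def relPos (i j : V) : (V → Plane) →ₗ[ℝ] Plane :=
  LinearMap.proj (R := ℝ) (φ := fun _ : V => Plane) i - LinearMap.proj (R := ℝ) (φ := fun _ : V => Plane) j

@[simp] lemma relPos_apply (i j : V) (x : V → Plane) : relPos i j x = x i - x j := rfl

/-- The bilinear form `⟪xᵢ - xⱼ, yᵢ - yⱼ⟫` attached to the pair `e = s(i, j)`. -/
noncomputable def edgeInner (e : Sym2 V) : (V → Plane) →ₗ[ℝ] (V → Plane) →ₗ[ℝ] ℝ :=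
  Sym2.lift ⟨fun i j => (innerₗ Plane).compl₁₂ (relPos i j) (relPos i j), fun i j => by
    refine LinearMap.ext₂ fun x y => ?_
    simp only [LinearMap.compl₁₂_apply, relPos_apply, innerₗ_apply_apply]
    rw [← neg_sub (x j), ← neg_sub (y j), inner_neg_neg]⟩ e

@[simp] lemma edgeInner_mk (i j : V) (x y : V → Plane) :
    edgeInner s(i, j) x y = ⟪x i - x j, y i - y j⟫ := rfl

@[simp] lemma edgeLength_mk (i j : V) (x : V → Plane) :
    edgeLength x s(i, j) = dist (x i) (x j) := rfl

lemma edgeInner_comm (e : Sym2 V) (x y : V → Plane) : edgeInner e x y = edgeInner e y x := by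
  induction e with | _ i j => simp [real_inner_comm]

lemma edgeInner_map {W : Type*} (g : W → V) (e : Sym2 W) (x y : V → Plane) :
    edgeInner (e.map g) x y = edgeInner e (x ∘ g) (y ∘ g) := by
  induction e with | _ i j => simp

lemma edgeLength_map {W : Type*} (g : W → V) (e : Sym2 W) (x : V → Plane) :
    edgeLength x (e.map g) = edgeLength (x ∘ g) e := by
  induction e with | _ i j => simp

/-- The second derivative at `p` of the potential of the single edge `e` with law `f`. -/
noncomputable def edgeForm (f : ℝ → ℝ) (p : V → Plane) (e : Sym2 V) :
    (V → Plane) →ₗ[ℝ] (V → Plane) →ₗ[ℝ] ℝ :=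
  f (edgeLength p e) • edgeInner e + (deriv f (edgeLength p e) / edgeLength p e) •
    (LinearMap.mul ℝ ℝ).compl₁₂ (edgeInner e p) (edgeInner e p)

lemma edgeForm_apply (f : ℝ → ℝ) (p : V → Plane) (e : Sym2 V) (x y : V → Plane) :
    edgeForm f p e x y = f (edgeLength p e) * edgeInner e x y +
      deriv f (edgeLength p e) / edgeLength p e * (edgeInner e p x * edgeInner e p y) := rfl

lemma edgeForm_comm (f : ℝ → ℝ) (p : V → Plane) (e : Sym2 V) (x y : V → Plane) :
    edgeForm f p e x y = edgeForm f p e y x := by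
  rw [edgeForm_apply, edgeForm_apply, edgeInner_comm, mul_comm (edgeInner e p x)]

lemma continuous_edgeLength (e : Sym2 V) : Continuous fun x : V → Plane => edgeLength x e := by
  induction e with | _ i j =>
  simp only [edgeLength_mk]
  fun_prop

lemma edgeLength_pos_of_mem {G : SimpleGraph V} {p : V → Plane} (hp : p ∈ configurationSpace G)
    {e : Sym2 V} (he : e ∈ G.edgeSet) : 0 < edgeLength p e := by
  induction e with | _ i j => exact dist_pos.mpr (hp i j he)

section Calculus

variable [Fintype V]

lemma hasFDerivAt_edgeLength (e : Sym2 V) {q : V → Plane} (hq : 0 < edgeLength q e) :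
    HasFDerivAt (fun x => edgeLength x e)
      ((edgeLength q e)⁻¹ • LinearMap.toContinuousLinearMap (edgeInner e q)) q := by
  induction e with | _ i j =>
  have h1 : HasFDerivAt (fun x : V → Plane => x i - x j)
      (LinearMap.toContinuousLinearMap (relPos i j)) q :=
    (LinearMap.toContinuousLinearMap (relPos i j : (V → Plane) →ₗ[ℝ] Plane)).hasFDerivAt
  have h2 := (h1.norm_sq).sqrt (by
    rw [edgeLength_mk, dist_eq_norm] at hq
    positivity)
  simp only [← dist_eq_norm, Real.sqrt_sq dist_nonneg] at h2
  refine h2.congr_fderiv (ContinuousLinearMap.ext fun y => ?_)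
  simp only [edgeLength_mk, smul_apply, ContinuousLinearMap.comp_apply,
    LinearMap.coe_toContinuousLinearMap', edgeInner_mk, smul_eq_mul, innerSL_apply_apply,
    relPos_apply, nsmul_eq_mul]
  ring

/-- The weight `t` in the integrand cancels the factor `1/d` from the derivative of the length. -/
lemma hasFDerivAt_edgePotential {f : ℝ → ℝ} (hf : ContDiffOn ℝ 1 f (Set.Ioi 0)) (e : Sym2 V)
    {q : V → Plane} (hq : 0 < edgeLength q e) :
    HasFDerivAt (fun x => ∫ t in (1 : ℝ)..(edgeLength x e), t * f t)
      (f (edgeLength q e) • LinearMap.toContinuousLinearMap (edgeInner e q)) q := by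
  have hcont : ContinuousOn (fun t => t * f t) (Set.Ioi 0) := continuousOn_id.mul hf.continuousOn
  have hmem : Set.Ioi (0 : ℝ) ∈ nhds (edgeLength q e) := Ioi_mem_nhds hq
  have hsub : Set.uIcc 1 (edgeLength q e) ⊆ Set.Ioi 0 := fun t ht =>
    lt_of_lt_of_le (lt_min one_pos hq) ht.1
  have h1 := intervalIntegral.integral_hasDerivAt_right (a := 1)
    (hcont.mono hsub).intervalIntegrable
    (hcont.stronglyMeasurableAtFilter isOpen_Ioi _ hq) (hcont.continuousAt hmem)
  have h2 := h1.comp_hasFDerivAt q (hasFDerivAt_edgeLength e hq)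
  refine h2.congr_fderiv ?_
  rw [smul_smul]
  congr 1
  field_simp

lemma hasFDerivAt_law_mul_edgeInner {f : ℝ → ℝ} (hf : ContDiffOn ℝ 1 f (Set.Ioi 0)) (e : Sym2 V)
    {p : V → Plane} (hp : 0 < edgeLength p e) (v : V → Plane) :
    HasFDerivAt (fun q => f (edgeLength q e) * edgeInner e q v)
      (LinearMap.toContinuousLinearMap ((edgeForm f p e).flip v)) p := by
  have h1 : HasDerivAt f (deriv f (edgeLength p e)) (edgeLength p e) :=
    ((hf.differentiableOn one_ne_zero).differentiableAt (Ioi_mem_nhds hp)).hasDerivAt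
  have h2 := h1.comp_hasFDerivAt p (hasFDerivAt_edgeLength e hp)
  have h3 : HasFDerivAt (fun q => edgeInner e q v)
      (LinearMap.toContinuousLinearMap ((edgeInner e).flip v)) p :=
    (LinearMap.toContinuousLinearMap ((edgeInner e).flip v)).hasFDerivAt
  refine (h2.mul h3).congr_fderiv (ContinuousLinearMap.ext fun w => ?_)
  simp only [LinearMap.coe_toContinuousLinearMap', LinearMap.flip_apply, edgeForm_apply,
    add_apply, smul_apply, smul_eq_mul,
    Function.comp_apply]
  ring

/-- The second derivative at `p` of the potential. -/
noncomputable def potentialForm (G : SimpleGraph V) (f : Sym2 V → ℝ → ℝ) (p : V → Plane) :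
    (V → Plane) →ₗ[ℝ] (V → Plane) →ₗ[ℝ] ℝ :=
  ∑ᶠ e ∈ G.edgeSet, edgeForm (f e) p e

open Classical in
lemma potentialForm_eq_sum (G : SimpleGraph V) (f : Sym2 V → ℝ → ℝ) (p : V → Plane) :
    potentialForm G f p = ∑ e ∈ G.edgeFinset, edgeForm (f e) p e := by
  rw [potentialForm, ← SimpleGraph.coe_edgeFinset, finsum_mem_coe_finset]

lemma potentialForm_apply (G : SimpleGraph V) (f : Sym2 V → ℝ → ℝ) (p x y : V → Plane) :
    potentialForm G f p x y = ∑ᶠ e ∈ G.edgeSet, edgeForm (f e) p e x y := by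
  classical
  rw [potentialForm_eq_sum, ← SimpleGraph.coe_edgeFinset, finsum_mem_coe_finset]
  simp [LinearMap.sum_apply]

lemma potentialForm_comm (G : SimpleGraph V) (f : Sym2 V → ℝ → ℝ) (p x y : V → Plane) :
    potentialForm G f p x y = potentialForm G f p y x := by
  simp only [potentialForm_apply, edgeForm_comm _ p _ x y]

lemma hessian_potential_apply {G : SimpleGraph V} {f : Sym2 V → ℝ → ℝ}
    (hf : ∀ e ∈ G.edgeSet, ContDiffOn ℝ 1 (f e) (Set.Ioi 0)) {p : V → Plane}
    (hp : p ∈ configurationSpace G) (a b : V × Fin 2) :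
    hessian (potential G f) p a b = potentialForm G f p (coordVec a) (coordVec b) := by
  classical
  -- Differentiating a second time requires the gradient formula on a whole neighbourhood of `p`,
  -- where all edge lengths stay positive.
  have hev : ∀ᶠ q in nhds p, ∀ e ∈ G.edgeFinset, 0 < edgeLength q e := by
    rw [Filter.eventually_all_finset]
    intro e he
    exact (continuous_edgeLength e).continuousAt.eventually
      (Ioi_mem_nhds (edgeLength_pos_of_mem hp (SimpleGraph.mem_edgeFinset.mp he)))
  have h1 : (fun q => fderiv ℝ (potential G f) q (coordVec b)) =ᶠ[nhds p]
      fun q => ∑ e ∈ G.edgeFinset, f e (edgeLength q e) * edgeInner e q (coordVec b) := by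
    filter_upwards [hev] with q hq
    have h := HasFDerivAt.fun_sum (u := G.edgeFinset) fun e he =>
      hasFDerivAt_edgePotential (hf e (SimpleGraph.mem_edgeFinset.mp he)) e (hq e he)
    have h' : HasFDerivAt (potential G f) (∑ e ∈ G.edgeFinset,
        f e (edgeLength q e) • LinearMap.toContinuousLinearMap (edgeInner e q)) q := by
      unfold potential
      convert h
    rw [h'.fderiv]
    simp
  have h2 := HasFDerivAt.fun_sum (u := G.edgeFinset)
    (A := fun e q => f e (edgeLength q e) * edgeInner e q (coordVec b)) fun e he =>
      hasFDerivAt_law_mul_edgeInner (hf e (SimpleGraph.mem_edgeFinset.mp he)) e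
        (hev.self_of_nhds e he) (coordVec b)
  change fderiv ℝ (fun q => fderiv ℝ (potential G f) q (coordVec b)) p (coordVec a) = _
  rw [h1.fderiv_eq, h2.fderiv, potentialForm_eq_sum]
  simp [LinearMap.sum_apply]

/-- The configuration with given coordinates. -/
noncomputable def configEquiv (V : Type*) : (V × Fin 2 → ℝ) ≃ₗ[ℝ] (V → Plane) :=
  (LinearEquiv.curry ℝ ℝ V (Fin 2)).trans
    (LinearEquiv.piCongrRight fun _ => (WithLp.linearEquiv 2 ℝ (Fin 2 → ℝ)).symm)

lemma configEquiv_eq_sum (u : V × Fin 2 → ℝ) : configEquiv V u = ∑ a, u a • coordVec a := by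
  classical
  ext i k
  have : ∀ a : V × Fin 2, (u a • coordVec a : V → Plane) i k = if a = (i, k) then u a else 0 := by
    rintro ⟨j, l⟩
    by_cases hj : j = i
    · subst hj
      by_cases hl : l = k
      · simp [coordVec, hl]
      · simp [coordVec, hl, Ne.symm hl]
    · simp [coordVec, hj, Ne.symm hj]
  simp only [Finset.sum_apply, WithLp.ofLp_sum, this, Finset.sum_ite_eq', Finset.mem_univ, if_true]
  rfl

lemma dotProduct_hessian_mulVec {G : SimpleGraph V} {f : Sym2 V → ℝ → ℝ}
    (hf : ∀ e ∈ G.edgeSet, ContDiffOn ℝ 1 (f e) (Set.Ioi 0)) {p : V → Plane}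
    (hp : p ∈ configurationSpace G) (u : V × Fin 2 → ℝ) :
    u ⬝ᵥ (hessian (potential G f) p).mulVec u =
      potentialForm G f p (configEquiv V u) (configEquiv V u) := by
  simp only [configEquiv_eq_sum, map_sum, LinearMap.sum_apply, map_smul, LinearMap.smul_apply,
    dotProduct, Matrix.mulVec, hessian_potential_apply hf hp, smul_eq_mul, Finset.mul_sum]
  rw [Finset.sum_comm]
  exact Finset.sum_congr rfl fun _ _ => Finset.sum_congr rfl fun _ _ => by ring

lemma isHermitian_hessian {G : SimpleGraph V} {f : Sym2 V → ℝ → ℝ}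
    (hf : ∀ e ∈ G.edgeSet, ContDiffOn ℝ 1 (f e) (Set.Ioi 0)) {p : V → Plane}
    (hp : p ∈ configurationSpace G) : (hessian (potential G f) p).IsHermitian := by
  ext a b
  simp [hessian_potential_apply hf hp, potentialForm_comm G f p (coordVec b)]

lemma hasNegIndex_potentialForm {G : SimpleGraph V} {f : Sym2 V → ℝ → ℝ}
    (hf : ∀ e ∈ G.edgeSet, ContDiffOn ℝ 1 (f e) (Set.Ioi 0)) {p : V → Plane}
    (hp : p ∈ configurationSpace G) :
    HasNegIndex (fun x => potentialForm G f p x x) (Fin (numNeg (hessian (potential G f) p))) ∧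
      HasNegIndex (fun x => -potentialForm G f p x x)
        (Fin (numPos (hessian (potential G f) p))) := by
  have hH := isHermitian_hessian hf hp
  constructor
  · simpa [dotProduct_hessian_mulVec hf hp] using
      (hasNegIndex_numNeg hH).comp_equiv (configEquiv V).symm
  · simpa [dotProduct_hessian_mulVec hf hp] using
      (hasNegIndex_numPos hH).comp_equiv (configEquiv V).symm

end Calculus

/-! ### Plane geometry: rotation, collinearity, linear independence. -/

/-- Rotation of the plane by a quarter turn. -/
noncomputable def rot : Plane →ₗ[ℝ] Plane :=
  (WithLp.linearEquiv 2 ℝ (Fin 2 → ℝ)).symm.toLinearMap ∘ₗ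
    Matrix.toLin' !![0, -1; 1, 0] ∘ₗ (WithLp.linearEquiv 2 ℝ (Fin 2 → ℝ)).toLinearMap

@[simp] lemma rot_apply_zero (x : Plane) : rot x 0 = -x 1 := by
  simp [rot, dotProduct, Fin.sum_univ_two]

@[simp] lemma rot_apply_one (x : Plane) : rot x 1 = x 0 := by
  simp [rot, dotProduct, Fin.sum_univ_two]

lemma inner_eq_coords (x y : Plane) : ⟪x, y⟫ = x 0 * y 0 + x 1 * y 1 := by
  simp [PiLp.inner_apply, Fin.sum_univ_two, mul_comm]

lemma inner_rot_right (x y : Plane) : ⟪x, rot y⟫ = -⟪y, rot x⟫ := by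
  simp only [inner_eq_coords, rot_apply_zero, rot_apply_one]
  ring

lemma inner_self_rot (x : Plane) : ⟪x, rot x⟫ = 0 := by
  simp only [inner_eq_coords, rot_apply_zero, rot_apply_one]
  ring

lemma exists_eq_smul_rot {d x : Plane} (hd : d ≠ 0) (h : ⟪d, x⟫ = 0) : ∃ s : ℝ, x = s • rot d := by
  have hpos : d 0 ^ 2 + d 1 ^ 2 ≠ 0 := by
    rw [sq, sq, ← inner_eq_coords]
    simpa using hd
  rw [inner_eq_coords] at h
  refine ⟨(d 0 * x 1 - d 1 * x 0) / (d 0 ^ 2 + d 1 ^ 2), ?_⟩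
  ext i
  fin_cases i
  · simp
    field_simp
    linear_combination d 0 * h
  · simp
    field_simp
    linear_combination d 1 * h

/-- Up to sign the inner product is the determinant of `a - c` and `b - c`. -/
lemma inner_rot_ne_zero_of_not_collinear {a b c : Plane} (h : ¬ Collinear ℝ {a, b, c}) :
    ⟪a - c, rot (b - c)⟫ ≠ 0 := by
  intro h0
  apply h
  rw [collinear_iff_of_mem (p₀ := c) (by simp)]
  by_cases hb : b - c = 0
  · refine ⟨a - c, ?_⟩
    rintro p (rfl | rfl | rfl)
    · exact ⟨1, by simp⟩
    · exact ⟨0, by simpa [sub_eq_zero] using hb⟩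
    · exact ⟨0, by simp⟩
  · have hrot : rot (b - c) ≠ 0 := fun h1 => hb <| by
      ext i
      fin_cases i
      · simpa using congrArg (fun z : Plane => z 1) h1
      · have h2 : rot (b - c) 0 = 0 := by simp [h1]
        rw [rot_apply_zero] at h2
        exact neg_eq_zero.mp h2
    obtain ⟨s, hs⟩ := exists_eq_smul_rot hrot (by rwa [real_inner_comm] at h0)
    refine ⟨b - c, ?_⟩
    rintro p (rfl | rfl | rfl)
    · refine ⟨-s, ?_⟩
      rw [vadd_eq_add, ← sub_eq_iff_eq_add, hs]
      ext i
      fin_cases i <;> simp <;> ring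
    · exact ⟨1, by simp⟩
    · exact ⟨0, by simp⟩

/-- Cramer's rule in the plane. -/
lemma exists_inner_eq {u w : Plane} (h : ⟪u, rot w⟫ ≠ 0) (α β : ℝ) :
    ∃ z : Plane, ⟪u, z⟫ = α ∧ ⟪w, z⟫ = β := by
  refine ⟨(α / ⟪u, rot w⟫) • rot w - (β / ⟪u, rot w⟫) • rot u, ?_, ?_⟩
  · rw [inner_sub_right, inner_smul_right, inner_smul_right, inner_self_rot]
    field_simp
    ring
  · rw [inner_sub_right, inner_smul_right, inner_smul_right, inner_self_rot, inner_rot_right w u]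
    field_simp
    ring

lemma eq_zero_of_smul_add_smul {u w : Plane} (h : ⟪u, rot w⟫ ≠ 0) {α β : ℝ}
    (h0 : α • u + β • w = 0) : α = 0 ∧ β = 0 := by
  have h1 := congrArg (fun z => ⟪z, rot w⟫) h0
  have h2 := congrArg (fun z => ⟪z, rot u⟫) h0
  simp only [inner_add_left, real_inner_smul_left, inner_self_rot, inner_zero_left,
    inner_rot_right w u, mul_zero, add_zero, zero_add, mul_neg, neg_eq_zero, mul_eq_zero, h,
    or_false] at h1 h2
  exact ⟨h1, h2⟩

lemma exists_sub_eq_smul_of_collinear {a b c : Plane} (h : Collinear ℝ {a, b, c}) (hab : a ≠ b) :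
    ∃ t : ℝ, c - a = t • (b - a) := by
  obtain ⟨d, hd⟩ := (collinear_iff_of_mem (p₀ := a) (by simp)).mp h
  obtain ⟨s, hs⟩ := hd b (by simp)
  obtain ⟨r, hr⟩ := hd c (by simp)
  rw [vadd_eq_add, ← sub_eq_iff_eq_add] at hs hr
  have hs0 : s ≠ 0 := by
    rintro rfl
    rw [zero_smul, sub_eq_zero] at hs
    exact hab hs.symm
  exact ⟨r / s, by rw [hr, hs, smul_smul, div_mul_cancel₀ _ hs0]⟩

/-! ### Rigid motions and equilibrium stresses. -/

/-- The infinitesimal rigid motions of the configuration `p`. -/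
noncomputable def rigidMotions (p : V → Plane) : Submodule ℝ (V → Plane) where
  carrier := {τ | ∃ (b : Plane) (s : ℝ), ∀ i, τ i = b + s • rot (p i)}
  add_mem' := by
    rintro x y ⟨b, s, h⟩ ⟨b', s', h'⟩
    exact ⟨b + b', s + s', fun i => by rw [Pi.add_apply, h, h', add_smul]; abel⟩
  zero_mem' := ⟨0, 0, by simp⟩
  smul_mem' := by
    rintro c x ⟨b, s, h⟩
    exact ⟨c • b, c * s, fun i => by rw [Pi.smul_apply, h, smul_add, smul_smul]⟩

/-- `a` is an equilibrium stress at `p` of the graph with edge set `C`, in virtual work form. -/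
def IsStress (C : Set (Sym2 V)) (a : Sym2 V → ℝ) (p : V → Plane) : Prop :=
  ∀ y : V → Plane, ∑ᶠ e ∈ C, a e * edgeInner e p y = 0

lemma edgeInner_congr {e : Sym2 V} {x y z : V → Plane} (h : ∀ i ∈ e, y i = z i) :
    edgeInner e x y = edgeInner e x z := by
  induction e with | _ i j => simp [h i, h j]

/-! ### The independent partition along a Henneberg sequence. -/

namespace HennebergSeq

variable {S : Set V} {E : Set (Sym2 V)}

lemma mem_of_mem_edge (h : HennebergSeq S E) : ∀ e ∈ E, ∀ v ∈ e, v ∈ S := by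
  induction h with
  | base a b hab => simp
  | step h v j k hv hjk ih =>
    have hj := ih _ hjk j (Sym2.mem_mk_left j k)
    have hk := ih _ hjk k (Sym2.mem_mk_right j k)
    rintro e (he | rfl | rfl) w hw
    · exact Or.inr (ih e he w hw)
    · rcases Sym2.mem_iff.mp hw with rfl | rfl
      exacts [Or.inr hj, Or.inl rfl]
    · rcases Sym2.mem_iff.mp hw with rfl | rfl
      exacts [Or.inr hk, Or.inl rfl]

lemma new_edge_notMem (h : HennebergSeq S E) {v : V} (hv : v ∉ S) (j : V) : s(j, v) ∉ E :=
  fun he => hv (h.mem_of_mem_edge _ he v (Sym2.mem_mk_right j v))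

lemma sUnion_independentPartition (h : HennebergSeq S E) (x : V → Plane) :
    ⋃₀ (h.independentPartition x : Set (Set (Sym2 V))) = E := by
  classical
  induction h with
  | base a b hab => simp [independentPartition]
  | step h v j k hv hjk ih =>
    rw [independentPartition]
    split_ifs with hc
    · have hjk' := hjk
      rw [← ih] at hjk'
      obtain ⟨C₀, hC₀, hjkC⟩ := hjk'
      ext e
      simp only [Finset.coe_image, Set.mem_sUnion, Set.mem_image, exists_exists_and_eq_and]
      constructor
      · rintro ⟨C, hC, he⟩
        have hCE : C ⊆ _ := fun e he => ih ▸ Set.mem_sUnion_of_mem he hC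
        split_ifs at he
        · exact Set.union_subset_union_left _ hCE he
        · exact Or.inl (hCE he)
      · rintro (he | he)
        · rw [← ih] at he
          obtain ⟨C, hC, he⟩ := he
          refine ⟨C, hC, ?_⟩
          split_ifs
          exacts [Or.inl he, he]
        · refine ⟨C₀, hC₀, ?_⟩
          rw [if_pos hjkC]
          exact Or.inr he
    · rw [Finset.coe_union, Set.sUnion_union, ih]
      rw [Finset.coe_pair, Set.sUnion_pair, Set.singleton_union]

lemma subset_of_mem_independentPartition (h : HennebergSeq S E) (x : V → Plane)
    {C : Set (Sym2 V)} (hC : C ∈ h.independentPartition x) : C ⊆ E := fun _ he =>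
  h.sUnion_independentPartition x ▸ Set.mem_sUnion_of_mem he hC

lemma pairwiseDisjoint_independentPartition (h : HennebergSeq S E) (x : V → Plane)
    (hx : ∀ e ∈ E, 0 < edgeLength x e) :
    (h.independentPartition x : Set (Set (Sym2 V))).PairwiseDisjoint id := by
  classical
  induction h with
  | base a b hab => simp [independentPartition]
  | step h v j k hv hjk ih =>
    have ih := ih fun e he => hx e (Or.inl he)
    have hsub : ∀ C ∈ h.independentPartition x, ∀ i, s(i, v) ∉ C := fun C hC i he =>
      h.new_edge_notMem hv i (h.subset_of_mem_independentPartition x hC he)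
    rw [independentPartition]
    split_ifs with hc
    · rw [Finset.coe_image]
      rintro _ ⟨C, hC, rfl⟩ _ ⟨D, hD, rfl⟩ hne
      have hCD : C ≠ D := fun hCD => hne (by rw [hCD])
      have hdis : Disjoint C D := ih hC hD hCD
      have hnew : ∀ A ∈ h.independentPartition x, Disjoint {s(j, v), s(k, v)} A := by
        intro A hA
        rw [Set.disjoint_left]
        rintro e (rfl | rfl)
        exacts [hsub A hA j, hsub A hA k]
      simp only [Function.onFun, id]
      split_ifs with h1 h2 h2
      · exact (Set.disjoint_left.mp hdis h1 h2).elim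
      · exact Set.disjoint_union_left.mpr ⟨hdis, hnew D hD⟩
      · exact Set.disjoint_union_right.mpr ⟨hdis, (hnew C hC).symm⟩
      · exact hdis
    -- A loop has length zero; with `j = k` the two new classes would coincide.
    · have hjk' : j ≠ k := by
        rintro rfl
        simpa using hx s(j, j) (Or.inl hjk)
      have hne : s(j, v) ≠ s(k, v) := fun h => hjk' (Sym2.congr_left.mp h)
      rw [Finset.coe_union]
      refine Set.pairwiseDisjoint_union.mpr ⟨ih, ?_, ?_⟩
      · simp [Set.pairwiseDisjoint_insert, hne]
      · rintro C hC D hD -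
        simp only [Finset.coe_insert, Finset.coe_singleton, Set.mem_insert_iff,
          Set.mem_singleton_iff] at hD
        rcases hD with rfl | rfl
        · simpa using hsub C hC j
        · simpa using hsub C hC k

lemma finsum_mem_union_pair [Finite V] {D : Set (Sym2 V)} {e₁ e₂ : Sym2 V} (h₁ : e₁ ∉ D)
    (h₂ : e₂ ∉ D) (hne : e₁ ≠ e₂) (F : Sym2 V → ℝ) :
    ∑ᶠ e ∈ D ∪ {e₁, e₂}, F e = ∑ᶠ e ∈ D, F e + (F e₁ + F e₂) := by
  rw [finsum_mem_union _ D.toFinite (Set.toFinite _), finsum_mem_pair hne]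
  rw [Set.disjoint_right]
  rintro e (rfl | rfl)
  exacts [h₁, h₂]

lemma finsum_mem_add_single [Finite V] [DecidableEq (Sym2 V)] {D : Set (Sym2 V)} {e₀ : Sym2 V} (h₀ : e₀ ∈ D)
    (F : Sym2 V → ℝ) (c : ℝ) :
    ∑ᶠ e ∈ D, (F e + if e = e₀ then c else 0) = ∑ᶠ e ∈ D, F e + c := by
  rw [finsum_mem_add_distrib D.toFinite]
  congr 1
  rw [finsum_eq_single _ e₀ fun e he => by simp [he]]
  simp [h₀]

/-- The classes of the independent partition are in equilibrium separately. -/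
theorem isStress_of_mem_independentPartition [Finite V] (h : HennebergSeq S E) (p : V → Plane)
    (hp : ∀ e ∈ E, 0 < edgeLength p e) (a : Sym2 V → ℝ) (ha : IsStress E a p) :
    ∀ C ∈ h.independentPartition p, IsStress C a p := by
  classical
  induction h generalizing a with
  | base i j hij =>
    intro C hC
    rw [independentPartition, Finset.mem_singleton] at hC
    rwa [hC]
  | @step S E h v j k hv hjk ih =>
    have ih := ih fun e he => hp e (Or.inl he)
    have hpjk : p j ≠ p k := dist_pos.mp (hp _ (Or.inl hjk))
    have hne : s(j, v) ≠ s(k, v) := fun h => hpjk (by rw [Sym2.congr_left.mp h])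
    have hj : j ≠ v := fun hj => hv (hj ▸ h.mem_of_mem_edge _ hjk j (Sym2.mem_mk_left j k))
    have hk : k ≠ v := fun hk => hv (hk ▸ h.mem_of_mem_edge _ hjk k (Sym2.mem_mk_right j k))
    have hsum := fun y => (finsum_mem_union_pair (h.new_edge_notMem hv j)
      (h.new_edge_notMem hv k) hne fun e => a e * edgeInner e p y).symm.trans (ha y)
    -- Virtual work is tested on the displacement that moves only `v`, by the resultant `z` itself.
    -- Only the two new edges contribute, and they give `-‖z‖² = 0`.
    have hforce : a s(j, v) • (p j - p v) + a s(k, v) • (p k - p v) = 0 := by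
      rw [← inner_self_eq_zero (𝕜 := ℝ)]
      set z := a s(j, v) • (p j - p v) + a s(k, v) • (p k - p v) with hz
      have h1 := hsum (Pi.single v z)
      have h2 : ∑ᶠ e ∈ E, a e * edgeInner e p (Pi.single v z) = 0 := by
        refine finsum_mem_eq_zero_of_forall_eq_zero fun e he => ?_
        rw [edgeInner_congr (z := 0) fun i hi => ?_, map_zero, mul_zero]
        refine Pi.single_eq_of_ne ?_ _
        rintro rfl
        exact hv (h.mem_of_mem_edge e he i hi)
      rw [h2] at h1
      simp only [edgeInner_mk, Pi.single_eq_same, Pi.single_eq_of_ne hj, Pi.single_eq_of_ne hk,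
        zero_sub, inner_neg_right] at h1
      conv_lhs => rw [hz, inner_add_left, real_inner_smul_left, real_inner_smul_left]
      linarith
    rw [independentPartition]
    split_ifs with hc
    · obtain ⟨t, ht⟩ := exists_sub_eq_smul_of_collinear hc hpjk
      have hbal : a s(j, v) * t + a s(k, v) * (t - 1) = 0 := by
        have h1 : (a s(j, v) * t + a s(k, v) * (t - 1)) • (p k - p j) = 0 := by
          have h2 : p j - p v = -(t • (p k - p j)) := by rw [← ht, neg_sub]
          have h3 : p k - p v = (p k - p j) - t • (p k - p j) := by rw [← ht]; abel
          rw [h2, h3] at hforce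
          rw [← neg_eq_zero, ← hforce]
          module
        exact (smul_eq_zero.mp h1).resolve_right (sub_ne_zero.mpr hpjk.symm)
      -- Since the two collinear forces balance at `v`, they act on `j` and `k` like one stress of
      -- size `a s(j, v) * t` on the edge `s(j, k)`.
      have hvirt : ∀ y : V → Plane, a s(j, v) * edgeInner s(j, v) p y +
          a s(k, v) * edgeInner s(k, v) p y = a s(j, v) * t * edgeInner s(j, k) p y := by
        intro y
        have h2 : p j - p v = (-t) • (p k - p j) := by rw [neg_smul, ← ht, neg_sub]
        have h3 : p k - p v = (1 - t) • (p k - p j) := by rw [sub_smul, one_smul, ← ht]; abel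
        have h4 : p j - p k = (-1 : ℝ) • (p k - p j) := by rw [neg_one_smul, neg_sub]
        simp only [edgeInner_mk, h2, h3, h4, real_inner_smul_left, inner_sub_right]
        linear_combination (⟪p k - p j, y v⟫ - ⟪p k - p j, y k⟫) * hbal
      let a' : Sym2 V → ℝ := fun e => a e + if e = s(j, k) then a s(j, v) * t else 0
      have hsame : ∀ D ⊆ E, s(j, k) ∈ D → ∀ y,
          ∑ᶠ e ∈ D ∪ {s(j, v), s(k, v)}, a e * edgeInner e p y =
            ∑ᶠ e ∈ D, a' e * edgeInner e p y := by
        intro D hD hjkD y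
        rw [finsum_mem_union_pair (fun he => h.new_edge_notMem hv j (hD he))
          (fun he => h.new_edge_notMem hv k (hD he)) hne, hvirt, ← finsum_mem_add_single hjkD]
        refine finsum_mem_congr rfl fun e _ => ?_
        simp only [a', add_mul]
        split_ifs with he
        · rw [he]
        · rw [zero_mul]
      -- Removing `v` leaves the modified stress `a'`, not `a`, in equilibrium; hence the induction
      -- over all stresses. The correction sits in the one class that also receives the new edges.
      have ih' := ih a' fun y => (hsame E subset_rfl hjk y).symm.trans (ha y)
      intro C' hC'
      obtain ⟨C, hC, rfl⟩ := Finset.mem_image.mp hC'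
      split_ifs with hjkC
      · intro y
        rw [hsame C (h.subset_of_mem_independentPartition p hC) hjkC]
        exact ih' C hC y
      · intro y
        rw [← ih' C hC y]
        refine finsum_mem_congr rfl fun e he => ?_
        rw [show a' e = a e by simp [a', show e ≠ s(j, k) from fun h => hjkC (h ▸ he)]]
    -- Independent directions cannot balance unless both new stresses vanish.
    · obtain ⟨h1, h2⟩ := eq_zero_of_smul_add_smul (inner_rot_ne_zero_of_not_collinear hc) hforce
      intro C hC
      rcases Finset.mem_union.mp hC with hC | hC
      · refine ih a (fun y => ?_) C hC
        have := hsum y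
        rwa [h1, h2, zero_mul, zero_mul, add_zero, add_zero] at this
      · rcases Finset.mem_insert.mp hC with rfl | hC
        · intro y
          rw [finsum_mem_singleton, h1, zero_mul]
        · rw [Finset.mem_singleton.mp hC]
          intro y
          rw [finsum_mem_singleton, h2, zero_mul]

/-- A single edge only constrains the component of the relative displacement along it; a discrepancy
orthogonal to the edge is an infinitesimal rotation. -/
lemma exists_rigid_of_inner_eq {x r y : V → Plane} {i v : V} (hiv : x i ≠ x v)
    (h : ⟪x i - x v, y v⟫ = ⟪x i - x v, y i - (r i - r v)⟫) :
    ∃ (b : Plane) (s : ℝ), ∀ l ∈ partVerts {s(i, v)}, y l = r l + (b + s • rot (x l)) := by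
  obtain ⟨s, hs⟩ := exists_eq_smul_rot (x := y i - (r i - r v) - y v) (sub_ne_zero.mpr hiv)
    (by rw [inner_sub_right, h, sub_self])
  refine ⟨y i - r i - s • rot (x i), s, ?_⟩
  rintro l ⟨e, rfl, hl⟩
  rcases Sym2.mem_iff.mp hl with rfl | rfl
  · abel
  · rw [map_sub, smul_sub] at hs
    have : y l = y i - (r i - r l) - (s • rot (x i) - s • rot (x l)) := by rw [← hs]; abel
    rw [this]
    abel

/-- Arbitrary displacements of the classes of the independent partition can be corrected by
infinitesimal rigid motions of the classes so as to fit together. -/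
theorem exists_displacement (h : HennebergSeq S E) (p : V → Plane)
    (hp : ∀ e ∈ E, 0 < edgeLength p e) (r : Set (Sym2 V) → V → Plane) :
    ∃ y : V → Plane, ∀ C ∈ h.independentPartition p,
      ∃ (b : Plane) (s : ℝ), ∀ i ∈ partVerts C, y i = r C i + (b + s • rot (p i)) := by
  classical
  induction h generalizing r with
  | base i j hij =>
    refine ⟨r {s(i, j)}, fun C hC => ⟨0, 0, fun l _ => ?_⟩⟩
    rw [independentPartition, Finset.mem_singleton] at hC
    simp [hC]
  | @step S E h v j k hv hjk ih =>
    have hpE : ∀ e ∈ E, 0 < edgeLength p e := fun e he => hp e (Or.inl he)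
    have ih := ih hpE
    have hj : j ≠ v := fun hj => hv (hj ▸ h.mem_of_mem_edge _ hjk j (Sym2.mem_mk_left j k))
    have hk : k ≠ v := fun hk => hv (hk ▸ h.mem_of_mem_edge _ hjk k (Sym2.mem_mk_right j k))
    have hold : ∀ C ∈ h.independentPartition p, ∀ i ∈ partVerts C, i ≠ v := by
      rintro C hC i ⟨e, he, hie⟩ rfl
      exact hv (h.mem_of_mem_edge e (h.subset_of_mem_independentPartition p hC he) i hie)
    rw [independentPartition]
    split_ifs with hc
    · set φ : Set (Sym2 V) → Set (Sym2 V) :=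
        fun C => if s(j, k) ∈ C then C ∪ {s(j, v), s(k, v)} else C with hφ
      -- Each old class uses the displacement prescribed for the class it becomes.
      obtain ⟨y, hy⟩ := ih fun C => r (φ C)
      obtain ⟨C₀, hC₀, hjkC₀⟩ : s(j, k) ∈ ⋃₀ (h.independentPartition p : Set (Set (Sym2 V))) :=
        (h.sUnion_independentPartition p).symm ▸ hjk
      obtain ⟨b₀, s₀, hy₀⟩ := hy C₀ hC₀
      -- The new vertex must follow the rigid correction already chosen for the class of `s(j, k)`;
      -- disjointness makes that class unique.
      refine ⟨Function.update y v (r (φ C₀) v + (b₀ + s₀ • rot (p v))), fun C' hC' => ?_⟩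
      obtain ⟨C, hC, rfl⟩ := Finset.mem_image.mp hC'
      by_cases hjkC : s(j, k) ∈ C
      · obtain rfl : C = C₀ := (h.pairwiseDisjoint_independentPartition p hpE).elim hC hC₀
          (Set.not_disjoint_iff.mpr ⟨_, hjkC, hjkC₀⟩)
        refine ⟨b₀, s₀, fun i hi => ?_⟩
        by_cases hiv : i = v
        · subst hiv
          rw [Function.update_self]
        · rw [Function.update_of_ne hiv]
          refine hy₀ i ?_
          obtain ⟨e, he, hie⟩ := hi
          rw [hφ] at he
          simp only [if_pos hjkC] at he
          rcases he with he | rfl | rfl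
          · exact ⟨e, he, hie⟩
          · exact ⟨_, hjkC, (Sym2.mem_iff.mp hie).resolve_right hiv ▸ Sym2.mem_mk_left j k⟩
          · exact ⟨_, hjkC, (Sym2.mem_iff.mp hie).resolve_right hiv ▸ Sym2.mem_mk_right j k⟩
      · obtain ⟨b, s, hbs⟩ := hy C hC
        have hφC : φ C = C := if_neg hjkC
        refine ⟨b, s, fun i hi => ?_⟩
        change i ∈ partVerts (φ C) at hi
        rw [hφC] at hi
        rw [Function.update_of_ne (hold C hC i hi)]
        exact hbs i hi
    · obtain ⟨y, hy⟩ := ih r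
      -- Each new edge imposes one scalar condition on the displacement of `v`; the two are
      -- independent because the triangle is nondegenerate.
      obtain ⟨z, hz₁, hz₂⟩ := exists_inner_eq (inner_rot_ne_zero_of_not_collinear hc)
        ⟪p j - p v, y j - (r {s(j, v)} j - r {s(j, v)} v)⟫
        ⟪p k - p v, y k - (r {s(k, v)} k - r {s(k, v)} v)⟫
      refine ⟨Function.update y v z, fun C hC => ?_⟩
      rcases Finset.mem_union.mp hC with hC | hC
      · obtain ⟨b, s, hbs⟩ := hy C hC
        refine ⟨b, s, fun i hi => ?_⟩
        rw [Function.update_of_ne (hold C hC i hi)]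
        exact hbs i hi
      · rcases Finset.mem_insert.mp hC with rfl | hC
        · refine exists_rigid_of_inner_eq (dist_pos.mp (hp s(j, v) (by simp))) ?_
          rwa [Function.update_self, Function.update_of_ne hj]
        · rw [Finset.mem_singleton.mp hC]
          refine exists_rigid_of_inner_eq (dist_pos.mp (hp s(k, v) (by simp))) ?_
          rwa [Function.update_self, Function.update_of_ne hk]

end HennebergSeq

/-! ### Virtual work and invariance under rigid motions. -/

/-- Translations cancel and `rot` is skew, so the rotation moves to the other argument. This turns a
Hessian pairing into virtual work of the rotated displacement. -/
lemma edgeInner_rigid {p n : V → Plane} {b : Plane} {s : ℝ} (hn : ∀ i, n i = b + s • rot (p i))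
    (e : Sym2 V) (y : V → Plane) :
    edgeInner e y n = -s * edgeInner e p fun i => rot (y i) := by
  induction e with | _ i j =>
  have : n i - n j = s • rot (p i - p j) := by rw [hn, hn, map_sub, smul_sub]; abel
  rw [edgeInner_mk, edgeInner_mk, this, inner_smul_right, inner_rot_right, map_sub]
  ring

section Equilibrium

variable [Fintype V]

open Classical in
lemma sum_adj_eq_two_mul_sum_edgeFinset (G : SimpleGraph V) (F : Sym2 V → ℝ) :
    ∑ i, ∑ j ∈ G.neighborFinset i, F s(i, j) = 2 * ∑ e ∈ G.edgeFinset, F e := by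
  have h1 : ∑ d : G.Dart, F d.edge = 2 * ∑ e ∈ G.edgeFinset, F e := by
    rw [← Finset.sum_fiberwise_of_maps_to (s := Finset.univ) (t := G.edgeFinset)
      (g := fun d : G.Dart => d.edge) (fun d _ => SimpleGraph.mem_edgeFinset.mpr d.edge_mem),
      Finset.mul_sum]
    refine Finset.sum_congr rfl fun e he => ?_
    rw [Finset.sum_congr rfl fun d hd => by rw [(Finset.mem_filter.mp hd).2], Finset.sum_const,
      G.dart_edge_fiber_card e (SimpleGraph.mem_edgeFinset.mp he), nsmul_eq_mul, Nat.cast_two]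
  rw [← h1, ← Finset.sum_fiberwise_of_maps_to (s := Finset.univ) (t := Finset.univ)
      (g := fun d : G.Dart => d.fst) (fun _ _ => Finset.mem_univ _)]
  refine Finset.sum_congr rfl fun i _ => ?_
  refine Finset.sum_bij' (fun j hj => ⟨(i, j), by simpa using hj⟩) (fun d _ => d.snd) ?_ ?_ ?_ ?_ ?_
  · intro j hj; simp
  · intro d hd
    simp only [Finset.mem_filter, Finset.mem_univ, true_and] at hd
    simp [← hd]
  · intro j hj; rfl
  · intro d hd
    simp only [Finset.mem_filter, Finset.mem_univ, true_and] at hd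
    subst hd; rfl
  · intro j hj; rfl

open Classical in
lemma sum_neighborFinset_swap (G : SimpleGraph V) (F : V → V → ℝ) :
    ∑ i, ∑ j ∈ G.neighborFinset i, F i j = ∑ i, ∑ j ∈ G.neighborFinset i, F j i :=
  Finset.sum_comm' (by simp [SimpleGraph.adj_comm])

/-- Equilibria satisfy the principle of virtual work. -/
lemma IsEquilibrium.isStress {G : SimpleGraph V} {f : Sym2 V → ℝ → ℝ} {p : V → Plane}
    (h : IsEquilibrium G f p) : IsStress G.edgeSet (fun e => f e (edgeLength p e)) p := by
  classical
  intro y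
  -- `F i j` is the work done at `i` by the force along `ij`; an edge's virtual work is minus the
  -- sum of its two end contributions.
  set F : V → V → ℝ := fun i j => f s(i, j) (dist (p i) (p j)) * ⟪p j - p i, y i⟫ with hF
  have h1 : ∑ i, ∑ j ∈ G.neighborFinset i, F i j = 0 := by
    refine Finset.sum_eq_zero fun i _ => ?_
    have h2 := congrArg (fun z => ⟪z, y i⟫) (h.2 i)
    simp only [sum_inner, real_inner_smul_left, inner_zero_left] at h2
    convert h2
  have h2 := sum_adj_eq_two_mul_sum_edgeFinset G fun e => f e (edgeLength p e) * edgeInner e p y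
  have h3 : ∑ i, ∑ j ∈ G.neighborFinset i,
      f s(i, j) (edgeLength p s(i, j)) * edgeInner s(i, j) p y =
        -(∑ i, ∑ j ∈ G.neighborFinset i, F i j) - ∑ i, ∑ j ∈ G.neighborFinset i, F j i := by
    simp only [← Finset.sum_neg_distrib, ← Finset.sum_sub_distrib]
    refine Finset.sum_congr rfl fun i _ => Finset.sum_congr rfl fun j _ => ?_
    simp only [hF, edgeLength_mk, edgeInner_mk, Sym2.eq_swap (a := j) (b := i),
      dist_comm (p j) (p i), inner_sub_right, inner_sub_left]
    ring
  rw [h3, ← sum_neighborFinset_swap G F, h1] at h2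
  rw [← SimpleGraph.coe_edgeFinset, finsum_mem_coe_finset]
  linarith

/-- The rank-one part vanishes because a rigid motion preserves lengths to first order. What remains
is `-s` times the virtual work of the stress on `rot ∘ y`, which is zero by equilibrium. -/
lemma potentialForm_rigidMotion {G : SimpleGraph V} {f : Sym2 V → ℝ → ℝ} {p : V → Plane}
    (h : IsStress G.edgeSet (fun e => f e (edgeLength p e)) p) {n : V → Plane}
    (hn : n ∈ rigidMotions p) (y : V → Plane) : potentialForm G f p y n = 0 := by
  obtain ⟨b, s, hn⟩ := hn
  have h0 : ∀ e, edgeInner e p n = 0 := by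
    intro e
    rw [edgeInner_rigid hn]
    induction e with | _ i j => rw [edgeInner_mk, ← map_sub, inner_self_rot, mul_zero]
  rw [potentialForm_apply]
  simp only [edgeForm_apply, h0, mul_zero, add_zero, edgeInner_rigid hn _ y]
  have := h fun i => rot (y i)
  rw [← mul_zero (-s), ← this, ← smul_eq_mul, smul_finsum_mem (Set.toFinite _)]
  simp only [smul_eq_mul]
  exact finsum_mem_congr rfl fun e _ => by ring

lemma potentialForm_add_rigidMotion {G : SimpleGraph V} {f : Sym2 V → ℝ → ℝ} {p : V → Plane}
    (h : IsStress G.edgeSet (fun e => f e (edgeLength p e)) p) {n : V → Plane}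
    (hn : n ∈ rigidMotions p) (y : V → Plane) :
    potentialForm G f p (y + n) (y + n) = potentialForm G f p y y := by
  rw [map_add, potentialForm_rigidMotion h hn, add_zero, potentialForm_comm, map_add,
    potentialForm_rigidMotion h hn, add_zero]

end Equilibrium

/-! ### Passage to the subsystem of a class. -/

section Part

variable {C : Set (Sym2 V)}

lemma image_edgeSet_partGraph (hC : ∀ e ∈ C, ¬ e.IsDiag) :
    Sym2.map Subtype.val '' (partGraph C).edgeSet = C := by
  ext e
  constructor
  · rintro ⟨e, he, rfl⟩
    induction e with | _ i j => exact he.1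
  · intro he
    induction e with | _ i j =>
    refine ⟨s(⟨i, s(i, j), he, Sym2.mem_mk_left i j⟩, ⟨j, s(i, j), he, Sym2.mem_mk_right i j⟩),
      ⟨he, fun hij => hC _ he ?_⟩, rfl⟩
    simpa using hij

lemma finsum_mem_edgeSet_partGraph (hC : ∀ e ∈ C, ¬ e.IsDiag) (F : Sym2 V → ℝ) :
    ∑ᶠ e ∈ (partGraph C).edgeSet, F (e.map Subtype.val) = ∑ᶠ e ∈ C, F e := by
  conv_rhs => rw [← image_edgeSet_partGraph hC]
  exact (finsum_mem_image (Sym2.map.injective Subtype.val_injective).injOn).symm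

lemma potentialForm_partGraph [Fintype V] (hC : ∀ e ∈ C, ¬ e.IsDiag) (f : Sym2 V → ℝ → ℝ)
    (p y : V → Plane) :
    potentialForm (partGraph C) (partLaws f C) (partConfig p C) (y ∘ Subtype.val)
      (y ∘ Subtype.val) = ∑ᶠ e ∈ C, edgeForm (f e) p e y y := by
  rw [potentialForm_apply, ← finsum_mem_edgeSet_partGraph hC]
  refine finsum_mem_congr rfl fun e _ => ?_
  simp only [edgeForm_apply, edgeInner_map, edgeLength_map]
  rfl

lemma isStress_partGraph (hC : ∀ e ∈ C, ¬ e.IsDiag) {f : Sym2 V → ℝ → ℝ} {p : V → Plane}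
    (h : IsStress C (fun e => f e (edgeLength p e)) p) :
    IsStress (partGraph C).edgeSet (fun e => partLaws f C e (edgeLength (partConfig p C) e))
      (partConfig p C) := by
  classical
  intro y
  -- Extension by zero is harmless: edges of `C` see only vertices of `partVerts C`.
  let y' : V → Plane := fun i => if hi : i ∈ partVerts C then y ⟨i, hi⟩ else 0
  have hy' : y' ∘ Subtype.val = y := by
    ext1 i
    exact dif_pos i.2
  rw [← h y', ← finsum_mem_edgeSet_partGraph hC]
  refine finsum_mem_congr rfl fun e _ => ?_
  simp only [edgeInner_map, edgeLength_map, hy']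
  rfl

lemma map_val_mem {e : Sym2 (partVerts C)} (he : e ∈ (partGraph C).edgeSet) :
    e.map Subtype.val ∈ C := by
  induction e with | _ i j => exact he.1

end Part

lemma hasNegIndex_partPotential [Fintype V] {G : SimpleGraph V} {f : Sym2 V → ℝ → ℝ} {p : V → Plane}
    (hf : ∀ e ∈ G.edgeSet, ContDiffOn ℝ 1 (f e) (Set.Ioi 0)) (hp : p ∈ configurationSpace G)
    {C : Set (Sym2 V)} (hC : C ⊆ G.edgeSet) :
    HasNegIndex (fun x => potentialForm (partGraph C) (partLaws f C) (partConfig p C) x x)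
        (Fin (numNeg (hessian (partPotential f C) (partConfig p C)))) ∧
      HasNegIndex (fun x => -potentialForm (partGraph C) (partLaws f C) (partConfig p C) x x)
        (Fin (numPos (hessian (partPotential f C) (partConfig p C)))) :=
  hasNegIndex_potentialForm (fun _ he => hf _ (hC (map_val_mem he)))
    fun i j hij => hp i j (hC (map_val_mem (e := s(i, j)) hij))

end Formation

/-! ### Assembly. -/

theorem proposition2 {V : Type*} [Fintype V] (G : SimpleGraph V)
    (hG : Formation.IsTriangulatedLaman G)
    (f : Sym2 V → ℝ → ℝ) (hf : ∀ e ∈ G.edgeSet, f e ∈ Formation.interactionLaws)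
    (p : V → Formation.Plane) (hp : Formation.IsEquilibrium G f p) :
    ∀ c : Formation.HennebergConstruction G,
      Formation.numNeg (Formation.hessian (Formation.potential G f) p) =
          ∑ C ∈ c.independentPartition p,
            Formation.numNeg
              (Formation.hessian (Formation.partPotential f C) (Formation.partConfig p C)) ∧
        Formation.numPos (Formation.hessian (Formation.potential G f) p) =
          ∑ C ∈ c.independentPartition p,
            Formation.numPos
              (Formation.hessian (Formation.partPotential f C) (Formation.partConfig p C)) := by
  open Formation in
  classical
  intro c
  have hf' : ∀ e ∈ G.edgeSet, ContDiffOn ℝ 1 (f e) (Set.Ioi 0) := fun e he => (hf e he).1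
  have hpos : ∀ e ∈ G.edgeSet, 0 < edgeLength p e := fun _ he => edgeLength_pos_of_mem hp.1 he
  have hsub : ∀ C ∈ c.independentPartition p, C ⊆ G.edgeSet :=
    fun C hC => c.subset_of_mem_independentPartition p hC
  have hdiag : ∀ C ∈ c.independentPartition p, ∀ e ∈ C, ¬ e.IsDiag :=
    fun C hC e he => G.not_isDiag_of_mem_edgeSet (hsub C hC he)
  let ι := {C // C ∈ c.independentPartition p}
  let R : ∀ C : ι, (V → Plane) →ₗ[ℝ] (partVerts C.1 → Plane) :=
    fun C => LinearMap.funLeft ℝ Plane Subtype.val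
  let N : ∀ C : ι, Submodule ℝ (partVerts C.1 → Plane) := fun C => rigidMotions (partConfig p C.1)
  let Q : ∀ C : ι, (partVerts C.1 → Plane) → ℝ :=
    fun C x => potentialForm (partGraph C.1) (partLaws f C.1) (partConfig p C.1) x x
  have hQ : ∀ x, potentialForm G f p x x = ∑ C, Q C (R C x) := by
    intro x
    rw [potentialForm_apply, finsum_mem_congr (c.sUnion_independentPartition p).symm
      fun _ _ => rfl, finsum_mem_sUnion (c.pairwiseDisjoint_independentPartition p hpos) (Finset.finite_toSet _)
        (fun C _ => C.toFinite), finsum_mem_coe_finset, ← Finset.sum_coe_sort]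
    exact Finset.sum_congr rfl fun C _ => (potentialForm_partGraph (hdiag C.1 C.2) f p x).symm
  have hN : ∀ C y, ∀ n ∈ N C, Q C (y + n) = Q C y := fun C y n hn =>
    potentialForm_add_rigidMotion (isStress_partGraph (hdiag C.1 C.2)
      (c.isStress_of_mem_independentPartition p hpos _ hp.isStress C.1 C.2)) hn y
  have hR : ∀ r : ∀ C : ι, partVerts C.1 → Plane, ∃ x, ∀ C, R C x - r C ∈ N C := by
    intro r
    -- The family is extended by zero to all sets and vertices; the default values are never read.
    obtain ⟨x, hx⟩ := c.exists_displacement p hpos fun C i =>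
      if h : ∃ hC : C ∈ c.independentPartition p, i ∈ partVerts C then r ⟨C, h.1⟩ ⟨i, h.2⟩ else 0
    refine ⟨x, fun C => ?_⟩
    obtain ⟨b, s, hbs⟩ := hx C.1 C.2
    refine ⟨b, s, fun i => ?_⟩
    have := hbs i.1 i.2
    rw [dif_pos ⟨C.2, i.2⟩] at this
    exact sub_eq_iff_eq_add'.mpr this
  have hG := hasNegIndex_potentialForm hf' hp.1
  have hC := fun C : ι => hasNegIndex_partPotential hf' hp.1 (hsub C.1 C.2)
  constructor
  · have := HasNegIndex.card_eq_sum R N hQ (fun C => by simp [Q]) hN hR hG.1 fun C => (hC C).1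
    simp only [Fintype.card_fin] at this
    rw [this]
    exact Finset.sum_coe_sort (c.independentPartition p) fun C =>
      numNeg (hessian (partPotential f C) (partConfig p C))
  -- The same argument for the negated forms.
  · have := HasNegIndex.card_eq_sum (Qᵢ := fun C x => -Q C x) R N
      (fun x => by rw [hQ, Finset.sum_neg_distrib]) (fun C => by simp [Q])
      (fun C y n hn => by rw [hN C y n hn]) hR hG.2 fun C => (hC C).2
    simp only [Fintype.card_fin] at this
    rw [this]
    exact Finset.sum_coe_sort (c.independentPartition p) fun C =>
      numPos (hessian (partPotential f C) (partConfig p C))
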